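/- Let $\mathcal H$ be a separable complex Hilbert space, $\varepsilon>0$, and let $S$ be a densely defined, closed, symmetric operator in $\mathcal H$ with $(u,Su)\ge\varepsilon\|u\|^2$ for all $u\in\operatorname{dom}(S)$ and with deficiency indices $(r,r)$, $r\in\mathbb N\cup\{\infty\}$, $r\ge 1$. Let $S_F\subseteq S^*$ be the Friedrichs extension of $S$, i.e. the restriction of $S^*$ to those $v\in\operatorname{dom}(S^*)$ for which there are $v_j\in\operatorname{dom}(S)$ with $v_j\to v$ and $(v_j-v_k,S(v_j-v_k))\to0$ as $j,k\to\infty$; let $S_K\subseteq S^*$ be the Krein--von Neumann extension of $S$, i.e. the restriction of $S^*$ to those $v\in\operatorname{dom}(S^*)$ for which there are $v_j\in\operatorname{dom}(S)$ with $Sv_j\to S^*v$ and $(v_j-v_k,S(v_j-v_k))\to0$. Let $P_{\ker(S_K)}$ be the orthogonal projection onto $\ker(S_K)$, $\widehat{\mathcal H}=[\ker(S_K)]^\perp$, and let $\widehat S_K=[I-P_{\ker(S_K)}]S_K[I-P_{\ker(S_K)}]$ in $\widehat{\mathcal H}$ (the restriction of $S_K$ to $\widehat{\mathcal H}$) be the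 reduced Krein--von Neumann operator. For $p\in(0,\infty]$ let $\mathcal B_p$ denote the compact operators whose singular values lie in $\ell^p$ ($\mathcal B_\infty$: all compact operators). Then $\mathbb C\setminus[\varepsilon,\infty)$ is contained in $\rho(S_F)$ and in $\rho(\widehat S_K)$, $\mathbb C\setminus([\varepsilon,\infty)\cup\{0\})\subseteq\rho(S_K)$, and $z\mapsto(S_K-z)^{-1}[I-P_{\ker(S_K)}]$ extends analytically to $\mathbb C\setminus[\varepsilon,\infty)$; at $z=0$ the symbol $(S_K-z)^{-1}[I-P_{\ker(S_K)}]$ denotes the value of this extension. Moreover: (i) Let $p\in(0,\infty]$. For each $z\in\mathbb C\setminus[\varepsilon,\infty)$, $$(S_K-z)^{-1}[I-P_{\ker(S_K)}]\in\mathcal B_p(\mathcal H)\iff(\widehat S_K-z)^{-1}\in\mathcal B_p(\widehat{\mathcal H}),$$ and if $(S_F-z_0)^{-1}\in\mathcal B_p(\mathcal H)$ for some $z_0\in\mathbb C\setminus[\varepsilon,\infty)$, then both of these hold for all $z\in\mathbb C\setminus[\varepsilon,\infty)$. The same statements hold with $\mathcal B_p(\mathcal H)$ replaced by any two-sided symmetrically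 normed ideal $\mathcal J$ of $\mathcal B(\mathcal H)$ (a two-sided ideal with a norm $|\cdot|$ satisfying $|ATB|\le\|A\|\,|T|\,\|B\|$), and $\mathcal B_p(\widehat{\mathcal H})$ by the set of those $A\in\mathcal B(\widehat{\mathcal H})$ whose extension by $0$ on $\ker(S_K)$ belongs to $\mathcal J$. (ii) Let $p\in(0,\infty]$. If $\widetilde S$ is a self-adjoint extension of $S$ with $0\in\rho(\widetilde S)$ and $(\widetilde S)^{-1}\in\mathcal B_p(\mathcal H)$, then $(\widehat S_K)^{-1}\in\mathcal B_p(\widehat{\mathcal H})$. -/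

import Mathlib

open Filter Topology
open scoped ENNReal

noncomputable section

namespace KreinVonNeumann

variable {H : Type*} [NormedAddCommGroup H] [InnerProductSpace ℂ H]

section Operators

/-- The kernel of a partially defined operator, as a subspace of the whole space. -/
def ker (T : H →ₗ.[ℂ] H) : Submodule ℂ H :=
  (LinearMap.ker T.toFun).map T.domain.subtype

/-- The kernel of `T - z`, as a subspace of the whole space. -/
def eigenspace (T : H →ₗ.[ℂ] H) (z : ℂ) : Submodule ℂ H :=
  (LinearMap.ker (T.toFun - z • T.domain.subtype)).map T.domain.subtype

/-- `R` is the bounded, everywhere defined two-sided inverse of `T - z`. -/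
def IsResolventAt (T : H →ₗ.[ℂ] H) (z : ℂ) (R : H →L[ℂ] H) : Prop :=
  (∀ x : H, ∃ hx : R x ∈ T.domain, T ⟨R x, hx⟩ - z • R x = x) ∧
    ∀ u : T.domain, R (T u - z • (u : H)) = u

/-- The resolvent set `ρ(T)`. -/
def rho (T : H →ₗ.[ℂ] H) : Set ℂ := {z | ∃ R : H →L[ℂ] H, IsResolventAt T z R}

open scoped Classical in
/-- The resolvent `(T - z)⁻¹`, for `z ∈ ρ(T)`; it is `0` by convention for other `z`. -/
def resolventOp (T : H →ₗ.[ℂ] H) (z : ℂ) : H →L[ℂ] H :=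
  if h : z ∈ rho T then Classical.choose h else 0

/-- The quadratic form `(u, T u)` of `T` (its real part; the form is real if `T` is symmetric). -/
def form (T : H →ₗ.[ℂ] H) (u : T.domain) : ℝ := (inner ℂ (u : H) (T u)).re

/-- `T` is symmetric and `(u, T u) ≥ 0` on its domain. -/
structure IsNonneg (T : H →ₗ.[ℂ] H) : Prop where
  symm : T.IsFormalAdjoint T
  nonneg : ∀ u : T.domain, 0 ≤ form T u

/-- `((w_j - w_k), T (w_j - w_k)) → 0` as `j, k → ∞`. -/
def FormCauchy (T : H →ₗ.[ℂ] H) (w : ℕ → T.domain) : Prop :=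
  Tendsto (fun p : ℕ × ℕ => form T (w p.1 - w p.2)) atTop (𝓝 0)

theorem FormCauchy.zero (T : H →ₗ.[ℂ] H) : FormCauchy T (fun _ => 0) := by
  simp [FormCauchy, form]

theorem form_smul (T : H →ₗ.[ℂ] H) (c : ℂ) (u : T.domain) :
    form T (c • u) = ‖c‖ ^ 2 * form T u := by
  simp only [form, LinearPMap.map_smul, Submodule.coe_smul, inner_smul_left, inner_smul_right]
  rw [← mul_assoc, Complex.mul_conj, Complex.re_ofReal_mul, Complex.normSq_eq_norm_sq]

theorem form_parallelogram (T : H →ₗ.[ℂ] H) (u v : T.domain) :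
    form T (u + v) + form T (u - v) = 2 * form T u + 2 * form T v := by
  simp only [form, LinearPMap.map_add, LinearPMap.map_sub, Submodule.coe_add,
    AddSubgroupClass.coe_sub, inner_add_left, inner_add_right, inner_sub_left, inner_sub_right,
    Complex.add_re, Complex.sub_re]
  ring

theorem FormCauchy.smul {T : H →ₗ.[ℂ] H} {w : ℕ → T.domain} (c : ℂ) (h : FormCauchy T w) :
    FormCauchy T (fun j => c • w j) := by
  have := Tendsto.const_mul (‖c‖ ^ 2) h
  simpa only [FormCauchy, ← smul_sub, form_smul, mul_zero] using this

theorem FormCauchy.add {T : H →ₗ.[ℂ] H} (hT : IsNonneg T) {w w' : ℕ → T.domain}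
    (h : FormCauchy T w) (h' : FormCauchy T w') : FormCauchy T (fun j => w j + w' j) := by
  have hs : Tendsto (fun p : ℕ × ℕ => 2 * form T (w p.1 - w p.2) + 2 * form T (w' p.1 - w' p.2))
      atTop (𝓝 0) := by
    simpa using (Tendsto.const_mul 2 h).add (Tendsto.const_mul 2 h')
  refine squeeze_zero (fun p => hT.nonneg _) (fun p => ?_) hs
  have h1 := form_parallelogram T (w p.1 - w p.2) (w' p.1 - w' p.2)
  have h2 := hT.nonneg ((w p.1 - w p.2) - (w' p.1 - w' p.2))
  rw [add_sub_add_comm]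
  linarith

variable [CompleteSpace H]

/-- The domain of the Friedrichs extension: those `v ∈ dom(S^*)` for which there are
`w_j ∈ dom(S)` with `w_j → v` and `((w_j - w_k), S (w_j - w_k)) → 0`. -/
def friedrichsDomain (S : H →ₗ.[ℂ] H) (hS : IsNonneg S) : Submodule ℂ H where
  carrier := {v | v ∈ S.adjoint.domain ∧ ∃ w : ℕ → S.domain,
    Tendsto (fun j => (w j : H)) atTop (𝓝 v) ∧ FormCauchy S w}
  zero_mem' := ⟨zero_mem _, fun _ => 0, by simp, FormCauchy.zero S⟩
  add_mem' := by
    rintro a b ⟨ha, w, hw, hc⟩ ⟨hb, w', hw', hc'⟩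
    exact ⟨add_mem ha hb, fun j => w j + w' j, by simpa using hw.add hw', hc.add hS hc'⟩
  smul_mem' := by
    rintro c a ⟨ha, w, hw, hc⟩
    exact ⟨Submodule.smul_mem _ c ha, fun j => c • w j, by simpa using hw.const_smul c, hc.smul c⟩

theorem friedrichsDomain_le (S : H →ₗ.[ℂ] H) (hS : IsNonneg S) :
    friedrichsDomain S hS ≤ S.adjoint.domain := fun _ h => h.1

/-- The Friedrichs extension `S_F` of a nonnegative operator `S`, a restriction of `S^*`
(Freudenthal's description). -/
def friedrichs (S : H →ₗ.[ℂ] H) (hS : IsNonneg S) : H →ₗ.[ℂ] H where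
  domain := friedrichsDomain S hS
  toFun := S.adjoint.toFun ∘ₗ Submodule.inclusion (friedrichsDomain_le S hS)

/-- The domain of the Krein--von Neumann extension: those `v ∈ dom(S^*)` for which there are
`w_j ∈ dom(S)` with `S w_j → S^* v` and `((w_j - w_k), S (w_j - w_k)) → 0`. -/
def kreinDomain (S : H →ₗ.[ℂ] H) (hS : IsNonneg S) : Submodule ℂ H where
  carrier := {v | ∃ hv : v ∈ S.adjoint.domain, ∃ w : ℕ → S.domain,
    Tendsto (fun j => S (w j)) atTop (𝓝 (S.adjoint ⟨v, hv⟩)) ∧ FormCauchy S w}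
  zero_mem' := by
    refine ⟨zero_mem _, fun _ => 0, ?_, FormCauchy.zero S⟩
    have h0 : S.adjoint ⟨0, zero_mem _⟩ = 0 := S.adjoint.map_zero
    rw [h0]
    simp
  add_mem' := by
    rintro a b ⟨ha, w, hw, hc⟩ ⟨hb, w', hw', hc'⟩
    refine ⟨add_mem ha hb, fun j => w j + w' j, ?_, hc.add hS hc'⟩
    have h0 : S.adjoint ⟨a + b, add_mem ha hb⟩ = S.adjoint ⟨a, ha⟩ + S.adjoint ⟨b, hb⟩ :=
      S.adjoint.map_add ⟨a, ha⟩ ⟨b, hb⟩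
    rw [h0]
    simpa only [LinearPMap.map_add] using hw.add hw'
  smul_mem' := by
    rintro c a ⟨ha, w, hw, hc⟩
    refine ⟨Submodule.smul_mem _ c ha, fun j => c • w j, ?_, hc.smul c⟩
    have h0 : S.adjoint ⟨c • a, Submodule.smul_mem _ c ha⟩ = c • S.adjoint ⟨a, ha⟩ :=
      S.adjoint.map_smul c ⟨a, ha⟩
    rw [h0]
    simpa only [LinearPMap.map_smul] using hw.const_smul c

theorem kreinDomain_le (S : H →ₗ.[ℂ] H) (hS : IsNonneg S) :
    kreinDomain S hS ≤ S.adjoint.domain := fun _ h => h.1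

/-- The Krein--von Neumann extension `S_K` of a nonnegative operator `S`, a restriction of `S^*`
(description of Ando and Nishio). -/
def krein (S : H →ₗ.[ℂ] H) (hS : IsNonneg S) : H →ₗ.[ℂ] H where
  domain := kreinDomain S hS
  toFun := S.adjoint.toFun ∘ₗ Submodule.inclusion (kreinDomain_le S hS)

/-- The orthogonal projection `P_{ker T}` in `H` onto the kernel of `T`. (The kernel of a closed
operator is closed, so the closure changes nothing for such `T`.) -/
def kerProj (T : H →ₗ.[ℂ] H) : H →L[ℂ] H := (ker T).topologicalClosure.starProjection

/-- The part `[I - P_{ker T}] T [I - P_{ker T}]` of `T` in the Hilbert space `(ker T)ᗮ`, with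
domain `dom(T) ∩ (ker T)ᗮ`. For symmetric `T` the range of `T` is orthogonal to `ker T`, and this
is the restriction of `T` to `(ker T)ᗮ`. -/
def reducedPart (T : H →ₗ.[ℂ] H) : (ker T)ᗮ →ₗ.[ℂ] (ker T)ᗮ where
  domain := T.domain.comap (ker T)ᗮ.subtype
  toFun := ((ker T)ᗮ.orthogonalProjectionOnto : H →ₗ[ℂ] (ker T)ᗮ) ∘ₗ T.toFun ∘ₗ
    ((ker T)ᗮ.subtype ∘ₗ (T.domain.comap (ker T)ᗮ.subtype).subtype).codRestrict
      T.domain (fun x => x.2)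

/-- The dimension of `ker(S^* - z)` in `ℕ ∪ {∞}`. -/
def deficiencyIndex (S : H →ₗ.[ℂ] H) (z : ℂ) : ℕ∞ :=
  Cardinal.toENat (Module.rank ℂ (eigenspace S.adjoint z))

/-- `S` is a densely defined, closed, symmetric operator with `S ≥ ε I` for the given `ε > 0`
and deficiency indices `(r, r)`, where `r ∈ {1, 2, …} ∪ {∞}`. -/
structure IsStrictlyPositive (S : H →ₗ.[ℂ] H) (ε : ℝ) : Prop where
  dense : Dense (S.domain : Set H)
  closed : S.IsClosed
  symm : S.IsFormalAdjoint S
  pos : 0 < ε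
  bound : ∀ u : S.domain, ε * ‖(u : H)‖ ^ 2 ≤ form S u
  deficiency : ∃ r : ℕ∞, r ≠ 0 ∧
    deficiencyIndex S Complex.I = r ∧ deficiencyIndex S (-Complex.I) = r

theorem IsStrictlyPositive.isNonneg {S : H →ₗ.[ℂ] H} {ε : ℝ} (h : IsStrictlyPositive S ε) :
    IsNonneg S :=
  ⟨h.symm, fun u => (mul_nonneg h.pos.le (sq_nonneg _)).trans (h.bound u)⟩

/-- The set `ℂ \ [ε, ∞)`. -/
def cutPlane (ε : ℝ) : Set ℂ := ((fun t : ℝ => (t : ℂ)) '' Set.Ici ε)ᶜ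

end Operators

section Ideals

/-- The `n`-th singular value (`n = 0, 1, 2, …`) of a bounded operator, as the distance in
operator norm to the operators of rank at most `n`. For compact `T` these are the eigenvalues of
`(T^* T)^{1/2}`, in decreasing order and repeated according to multiplicity. -/
def singularValue (T : H →L[ℂ] H) (n : ℕ) : ℝ :=
  ⨅ F : {F : H →L[ℂ] H // LinearMap.rank (F : H →ₗ[ℂ] H) ≤ n}, ‖T - F.1‖

/-- `T ∈ B_p(H)`, `p ∈ (0, ∞]`: `T` is compact and its singular values lie in `ℓ^p`. For `p = ∞`
the second condition is automatic, and `B_∞(H)` consists of all compact operators. -/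
def IsSchatten (p : ℝ≥0∞) (T : H →L[ℂ] H) : Prop :=
  IsCompactOperator T ∧ Memℓp (singularValue T) p

/-- A two-sided symmetrically normed ideal of `B(H)`: a two-sided ideal with a norm such that
`|A T B| ≤ ‖A‖ |T| ‖B‖`. Completeness, or a normalization on operators of rank one, is not
required, so that ideals with these further properties are included. -/
structure SymmNormedIdeal (H : Type*) [NormedAddCommGroup H] [InnerProductSpace ℂ H] where
  carrier : Submodule ℂ (H →L[ℂ] H)
  mul_mem : ∀ (A : H →L[ℂ] H) {T : H →L[ℂ] H} (B : H →L[ℂ] H),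
    T ∈ carrier → A * T * B ∈ carrier
  norm : Seminorm ℂ carrier
  eq_zero : ∀ T : carrier, norm T = 0 → T = 0
  norm_mul_le : ∀ (A : H →L[ℂ] H) (T : carrier) (B : H →L[ℂ] H),
    norm ⟨A * T * B, mul_mem A B T.2⟩ ≤ ‖A‖ * norm T * ‖B‖

variable [CompleteSpace H]

/-- The extension by zero on `Kᗮ` of a bounded operator `A` in the closed subspace `K`. -/
def extendZero (K : Submodule ℂ H) [K.HasOrthogonalProjection] (A : K →L[ℂ] K) : H →L[ℂ] H :=
  K.subtypeL ∘L A ∘L K.orthogonalProjectionOnto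

/-- The ideal of `B(K)` that belongs to the ideal `J` of `B(H)`, for a closed subspace `K`: the
operators whose extension by zero lies in `J`. -/
def SymmNormedIdeal.onSubspace (J : SymmNormedIdeal H) (K : Submodule ℂ H)
    [K.HasOrthogonalProjection] : Set (K →L[ℂ] K) :=
  {A | extendZero K A ∈ J.carrier}

end Ideals

end KreinVonNeumann

end

/-!
Put `K = (ker S_K)ᗮ`. Since `S` is closed and bounded below by `ε > 0`, its range is closed, the
domain of `S_K` is `dom(S) + ker(S^*)`, and `S_K (u + k) = S u`. So `ker S_K = ker S^*`, `K` is the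
range of `S`, and the reduced operator sends the projection of `u ∈ dom(S)` to `K` to `S u`. If `B`
is any bounded operator with `B (S u) = u` on `dom(S)`, it follows that the reduced operator has the
inverse `A = P_K B|_K` (`isResolventAt_reducedPart_zero`). The inverse of every boundedly invertible
extension of `S` is such a `B`, and this gives the last assertion of the theorem.

For the other assertions, take `B = S_F⁻¹`, a positive operator with `‖B‖ ≤ 1 / ε`
(`exists_friedrichs_inverse`). Surjectivity of `S_F` is obtained by minimizing the energy
`(u, S u) - 2 Re (f, u)` over `dom(S)` (`friedrichs_surjective`). The compression `A` inherits
positivity and the norm bound, so `1 - z B` and `1 - z A` are invertible for `z` off `[ε, ∞)`, and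
`(S_F - z)⁻¹ = B (1 - z B)⁻¹`, `(Ŝ_K - z)⁻¹ = A (1 - z A)⁻¹`. The resolvent of `S_K` is the
orthogonal sum of the latter and of `-z⁻¹` on `ker S_K` (`isResolventAt_of_reducedPart`), so the
extension by zero of `A (1 - z A)⁻¹` is the required analytic continuation.

Membership in an ideal then passes along products only: from `(S_F - z₀)⁻¹` to
`B = (S_F - z₀)⁻¹ (1 - z₀ B)`, to its compression `A`, and to `A (1 - z A)⁻¹`. For the Schatten
classes, where the compression changes the Hilbert space, this rests on the estimate
`singularValue_comp_le`.
-/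

namespace KreinVonNeumann

/-! ### Resolvents of operators with a bounded positive inverse -/

section Resolvents

variable {E : Type*} [NormedAddCommGroup E] [InnerProductSpace ℂ E]

theorem IsResolventAt.eq {T : E →ₗ.[ℂ] E} {z : ℂ} {R R' : E →L[ℂ] E}
    (h : IsResolventAt T z R) (h' : IsResolventAt T z R') : R = R' := by
  ext x
  obtain ⟨hx, hRx⟩ := h.1 x
  have := h'.2 ⟨R x, hx⟩
  rw [hRx] at this
  exact this.symm

theorem IsResolventAt.mem_rho {T : E →ₗ.[ℂ] E} {z : ℂ} {R : E →L[ℂ] E}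
    (h : IsResolventAt T z R) : z ∈ rho T := ⟨R, h⟩

theorem isResolventAt_resolventOp {T : E →ₗ.[ℂ] E} {z : ℂ} (h : z ∈ rho T) :
    IsResolventAt T z (resolventOp T z) := by
  rw [resolventOp, dif_pos h]
  exact Classical.choose_spec h

theorem IsResolventAt.resolventOp_eq {T : E →ₗ.[ℂ] E} {z : ℂ} {R : E →L[ℂ] E}
    (h : IsResolventAt T z R) : resolventOp T z = R :=
  (isResolventAt_resolventOp h.mem_rho).eq h

/-- If `B = T⁻¹`, then `(T - z)⁻¹ = B (1 - z B)⁻¹`. -/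
theorem IsResolventAt.mul_inverse {T : E →ₗ.[ℂ] E} {B : E →L[ℂ] E} (h : IsResolventAt T 0 B)
    {z : ℂ} (hu : IsUnit (1 - z • B)) :
    IsResolventAt T z (B * Ring.inverse (1 - z • B)) := by
  set U := Ring.inverse (1 - z • B) with hU
  have h1 : (1 - z • B) * U = 1 := Ring.mul_inverse_cancel _ hu
  have h2 : U * (1 - z • B) = 1 := Ring.inverse_mul_cancel _ hu
  have hcomm : B * U = U * B := by
    have hc : Commute (1 - z • B) B :=
      (Commute.one_left B).sub_left ((Commute.refl B).smul_left z)
    calc B * U = (U * (1 - z • B)) * (B * U) := by rw [h2, one_mul]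
      _ = U * ((1 - z • B) * B) * U := by simp only [mul_assoc]
      _ = U * (B * (1 - z • B)) * U := by rw [hc.eq]
      _ = U * B * ((1 - z • B) * U) := by simp only [mul_assoc]
      _ = U * B := by rw [h1, mul_one]
  refine ⟨fun x => ?_, fun u => ?_⟩
  · obtain ⟨hx, hBx⟩ := h.1 (U x)
    rw [zero_smul, sub_zero] at hBx
    refine ⟨hx, ?_⟩
    have := DFunLike.congr_fun h1 x
    change T ⟨B (U x), hx⟩ - z • B (U x) = x
    rw [hBx]
    exact this
  · have hBu := h.2 u
    rw [zero_smul, sub_zero] at hBu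
    rw [hcomm]
    have := DFunLike.congr_fun h2 (u : E)
    change U (B (T u - z • (u : E))) = u
    rw [map_sub, map_smul, hBu]
    exact this

variable [CompleteSpace E]

/-- The spectrum of a positive `B` with `‖B‖ ≤ 1 / ε` lies in `[0, 1 / ε]`, so it does not contain
`z⁻¹` for `z` off `[ε, ∞)`. -/
theorem isUnit_one_sub_smul {B : E →L[ℂ] E} {ε : ℝ} (hε : 0 < ε) (hB : B.IsPositive)
    (hn : ‖B‖ ≤ 1 / ε) {z : ℂ} (hz : z ∈ cutPlane ε) : IsUnit (1 - z • B) := by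
  rcases subsingleton_or_nontrivial E with hE | hE
  · exact isUnit_of_subsingleton _
  by_cases hz0 : z = 0
  · simp [hz0]
  by_contra hu
  have hmem : z⁻¹ ∈ spectrum ℂ B := by
    rw [spectrum.mem_iff]
    intro h
    apply hu
    have h2 : 1 - z • B = (Units.mk0 z hz0) • (algebraMap ℂ (E →L[ℂ] E) z⁻¹ - B) := by
      rw [Units.smul_def, Units.val_mk0, smul_sub, Algebra.algebraMap_eq_smul_one, smul_smul,
        mul_inv_cancel₀ hz0, one_smul]
    rw [h2]
    exact h.smul _
  have hsa : IsSelfAdjoint B := hB.isSelfAdjoint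
  have hre := hsa.mem_spectrum_eq_re hmem
  have hnorm : ‖z⁻¹‖ ≤ 1 / ε := (spectrum.norm_le_norm_of_mem hmem).trans hn
  have hpos : 0 ≤ (z⁻¹).re := by
    have h0 : (0 : E →L[ℂ] E) ≤ B := (ContinuousLinearMap.nonneg_iff_isPositive B).2 hB
    rw [hre] at hmem
    exact spectrum_nonneg_of_nonneg h0 ((spectrum.algebraMap_mem_iff ℂ).1 hmem)
  apply hz
  set r := (z⁻¹).re with hr
  have hr0 : r ≠ 0 := by
    rintro h0
    rw [h0] at hre
    simp [hz0] at hre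
  have hrp : 0 < r := lt_of_le_of_ne hpos hr0.symm
  refine ⟨r⁻¹, ?_, ?_⟩
  · rw [hre, Complex.norm_real, Real.norm_of_nonneg hpos] at hnorm
    rw [Set.mem_Ici, le_inv_comm₀ hε hrp]
    simpa using hnorm
  · have : ((r : ℂ))⁻¹ = z := by rw [← hre, inv_inv]
    simpa using this

end Resolvents

/-! ### Singular values and ideals under compression -/

section Ideals

universe u
variable {E F : Type u} [NormedAddCommGroup E] [InnerProductSpace ℂ E]
  [NormedAddCommGroup F] [InnerProductSpace ℂ F]

theorem singularValue_nonneg (T : E →L[ℂ] E) (n : ℕ) : 0 ≤ singularValue T n :=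
  Real.iInf_nonneg fun _ => norm_nonneg _

theorem singularValue_comp_le (T : E →L[ℂ] E) (C : E →L[ℂ] F) (D : F →L[ℂ] E) (n : ℕ) :
    singularValue (C ∘L T ∘L D) n ≤ ‖C‖ * ‖D‖ * singularValue T n := by
  have : Nonempty {G : E →L[ℂ] E // LinearMap.rank (G : E →ₗ[ℂ] E) ≤ n} :=
    ⟨⟨0, by simp [LinearMap.rank_zero]⟩⟩
  unfold singularValue
  rw [Real.mul_iInf_of_nonneg (by positivity)]
  refine le_ciInf fun G => ?_
  have hrank : LinearMap.rank ((C ∘L G.1 ∘L D : F →L[ℂ] F) : F →ₗ[ℂ] F) ≤ n := by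
    have h1 : LinearMap.rank ((C ∘L G.1 ∘L D : F →L[ℂ] F) : F →ₗ[ℂ] F) ≤
        LinearMap.rank ((G.1 : E →ₗ[ℂ] E) ∘ₗ (D : F →ₗ[ℂ] E)) :=
      LinearMap.rank_comp_le_right ((G.1 : E →ₗ[ℂ] E) ∘ₗ (D : F →ₗ[ℂ] E)) (C : E →ₗ[ℂ] F)
    exact (h1.trans (LinearMap.rank_comp_le_left (D : F →ₗ[ℂ] E) (G.1 : E →ₗ[ℂ] E))).trans G.2
  refine (ciInf_le ⟨0, ?_⟩ (⟨C ∘L G.1 ∘L D, hrank⟩ :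
    {G : F →L[ℂ] F // LinearMap.rank (G : F →ₗ[ℂ] F) ≤ n})).trans ?_
  · rintro _ ⟨_, rfl⟩
    exact norm_nonneg _
  · have : C ∘L T ∘L D - C ∘L G.1 ∘L D = C ∘L (T - G.1) ∘L D := by
      ext x
      simp
    change ‖C ∘L T ∘L D - C ∘L G.1 ∘L D‖ ≤ _
    rw [this]
    calc ‖C ∘L (T - G.1) ∘L D‖ ≤ ‖C‖ * (‖T - G.1‖ * ‖D‖) :=
          (C.opNorm_comp_le _).trans
            (mul_le_mul_of_nonneg_left ((T - G.1).opNorm_comp_le D) (norm_nonneg _))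
      _ = ‖C‖ * ‖D‖ * ‖T - G.1‖ := by ring

theorem IsSchatten.comp {p : ℝ≥0∞} {T : E →L[ℂ] E} (h : IsSchatten p T) (C : E →L[ℂ] F)
    (D : F →L[ℂ] E) : IsSchatten p (C ∘L T ∘L D) := by
  refine ⟨(h.1.comp_clm D).clm_comp C, (h.2.const_mul (‖C‖ * ‖D‖)).mono fun n => ?_⟩
  rw [Real.norm_of_nonneg (singularValue_nonneg _ _)]
  exact singularValue_comp_le T C D n

theorem IsSchatten.mul_right {p : ℝ≥0∞} {T : E →L[ℂ] E} (h : IsSchatten p T) (D : E →L[ℂ] E) :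
    IsSchatten p (T * D) :=
  h.comp (ContinuousLinearMap.id ℂ E) D

theorem SymmNormedIdeal.mul_right_mem (J : SymmNormedIdeal E) {T : E →L[ℂ] E}
    (h : T ∈ J.carrier) (D : E →L[ℂ] E) : T * D ∈ J.carrier := by
  simpa using J.mul_mem 1 D h

variable (K : Submodule ℂ E) [K.HasOrthogonalProjection]

theorem extendZero_mul (A B : K →L[ℂ] K) :
    extendZero K (A * B) = extendZero K A * extendZero K B := by
  ext x
  simp [extendZero]

theorem compress_extendZero (A : K →L[ℂ] K) :
    K.orthogonalProjectionOnto ∘L extendZero K A ∘L K.subtypeL = A := by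
  ext x
  simp [extendZero]

theorem isSchatten_extendZero_iff {p : ℝ≥0∞} (A : K →L[ℂ] K) :
    IsSchatten p (extendZero K A) ↔ IsSchatten p A := by
  refine ⟨fun h => ?_, fun h => h.comp K.subtypeL K.orthogonalProjectionOnto⟩
  have := h.comp K.orthogonalProjectionOnto K.subtypeL
  rwa [compress_extendZero] at this

end Ideals

/-! ### The inverse of the Friedrichs extension -/

section Friedrichs

variable {H : Type*} [NormedAddCommGroup H] [InnerProductSpace ℂ H]

theorem form_add {S : H →ₗ.[ℂ] H} (hS : S.IsFormalAdjoint S) (a b : S.domain) :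
    form S (a + b) = form S a + form S b + 2 * (inner ℂ (a : H) (S b)).re := by
  have h : (inner ℂ (b : H) (S a)).re = (inner ℂ (a : H) (S b)).re := by
    rw [← hS b a, ← inner_conj_symm, Complex.conj_re]
  simp only [form, LinearPMap.map_add, Submodule.coe_add, inner_add_left, inner_add_right,
    Complex.add_re, h]
  ring

theorem form_real_smul (S : H →ₗ.[ℂ] H) (t : ℝ) (u : S.domain) :
    form S ((t : ℂ) • u) = t ^ 2 * form S u := by
  rw [form_smul, Complex.norm_real, Real.norm_eq_abs, sq_abs]

/-- The Cauchy-Schwarz inequality for the imaginary part of `⟨a, S b⟩`, linearized by a real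
parameter `t`. -/
theorem two_mul_im_le {S : H →ₗ.[ℂ] H} (hS : IsNonneg S) (a b : S.domain) (t : ℝ) :
    2 * t * (inner ℂ (a : H) (S b)).im ≤ t ^ 2 * form S a + form S b := by
  have h := hS.nonneg ((t : ℂ) • a + Complex.I • b)
  rw [form_add hS.symm, form_real_smul, form_smul] at h
  simp only [LinearPMap.map_smul, Submodule.coe_smul, inner_smul_left, inner_smul_right,
    Complex.norm_I, Complex.conj_ofReal] at h
  simp at h
  linarith

theorem FormCauchy.eventually_le {S : H →ₗ.[ℂ] H} {w : ℕ → S.domain} (h : FormCauchy S w)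
    {δ : ℝ} (hδ : 0 < δ) : ∃ N, ∀ j ≥ N, ∀ k ≥ N, form S (w j - w k) ≤ δ := by
  have h1 : ∀ᶠ p : ℕ × ℕ in atTop, form S (w p.1 - w p.2) < δ := h.eventually_lt_const hδ
  obtain ⟨⟨N, M⟩, hN⟩ := eventually_atTop.1 h1
  exact ⟨max N M, fun j hj k hk =>
    (hN (j, k) ⟨(le_max_left _ _).trans hj, (le_max_right _ _).trans hk⟩).le⟩

theorem FormCauchy.cauchySeq {S : H →ₗ.[ℂ] H} {ε : ℝ} (hε : 0 < ε)
    (hb : ∀ u : S.domain, ε * ‖(u : H)‖ ^ 2 ≤ form S u) {w : ℕ → S.domain}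
    (h : FormCauchy S w) : CauchySeq fun j => (w j : H) := by
  rw [Metric.cauchySeq_iff]
  intro δ hδ
  obtain ⟨N, hN⟩ := h.eventually_le (δ := ε * (δ / 2) ^ 2) (by positivity)
  refine ⟨N, fun j hj k hk => ?_⟩
  have h1 := (hb (w j - w k)).trans (hN j hj k hk)
  have h2 : ‖((w j - w k : S.domain) : H)‖ ≤ δ / 2 :=
    (sq_le_sq₀ (norm_nonneg _) (by positivity)).1 (le_of_mul_le_mul_left h1 hε)
  rw [dist_eq_norm]
  have : ‖(w j : H) - w k‖ ≤ δ / 2 := h2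
  linarith

variable [CompleteSpace H]

theorem inner_adjoint_left {S : H →ₗ.[ℂ] H} (hd : Dense (S.domain : Set H))
    (v : S.adjoint.domain) (u : S.domain) : inner ℂ (v : H) (S u) = inner ℂ (S.adjoint v) (u : H) :=
  (S.adjoint_isFormalAdjoint hd v u).symm

/-- The lower bound `ε` of `S` carries over to the Friedrichs extension. -/
theorem friedrichs_lower_bound {S : H →ₗ.[ℂ] H} {ε : ℝ} (hS : IsStrictlyPositive S ε)
    (v : (friedrichs S hS.isNonneg).domain) :
    ε * ‖(v : H)‖ ^ 2 ≤ (inner ℂ (friedrichs S hS.isNonneg v) (v : H)).re := by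
  obtain ⟨v, hv, w, hw, hc⟩ := v
  change ε * ‖v‖ ^ 2 ≤ (inner ℂ (S.adjoint ⟨v, hv⟩) v).re
  have key : ∀ δ > 0, ε * ‖v‖ ^ 2 ≤ (inner ℂ (S.adjoint ⟨v, hv⟩) v).re + δ / 2 := by
    intro δ hδ
    obtain ⟨N, hN⟩ := hc.eventually_le hδ
    have h1 : ∀ j ≥ N, ∀ k ≥ N, (ε * ‖(w j : H)‖ ^ 2 + ε * ‖(w k : H)‖ ^ 2) / 2 ≤
        (inner ℂ (w j : H) (S (w k))).re + δ / 2 := by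
      intro j hj k hk
      have e1 := form_add hS.symm (w j) (-w k)
      have e2 : form S (-w k) = form S (w k) := by simp [form, LinearPMap.map_neg]
      rw [← sub_eq_add_neg, e2, LinearPMap.map_neg, inner_neg_right, Complex.neg_re] at e1
      linarith [hN j hj k hk, hS.bound (w j), hS.bound (w k)]
    have h2 : ∀ k ≥ N, (ε * ‖v‖ ^ 2 + ε * ‖(w k : H)‖ ^ 2) / 2 ≤
        (inner ℂ (S.adjoint ⟨v, hv⟩) (w k : H)).re + δ / 2 := by
      intro k hk
      rw [← inner_adjoint_left hS.dense]
      refine le_of_tendsto_of_tendsto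
        ((((hw.norm.pow 2).const_mul ε).add_const _).div_const 2)
        ((Complex.continuous_re.tendsto _).comp (hw.inner tendsto_const_nhds) |>.add_const _) ?_
      filter_upwards [eventually_ge_atTop N] with j hj using h1 j hj k hk
    have h3 : (ε * ‖v‖ ^ 2 + ε * ‖v‖ ^ 2) / 2 ≤ (inner ℂ (S.adjoint ⟨v, hv⟩) v).re + δ / 2 := by
      refine le_of_tendsto_of_tendsto
        ((((hw.norm.pow 2).const_mul ε).const_add _).div_const 2)
        ((Complex.continuous_re.tendsto _).comp (tendsto_const_nhds.inner hw) |>.add_const _) ?_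
      filter_upwards [eventually_ge_atTop N] with k hk using h2 k hk
    linarith
  refine le_of_forall_pos_le_add fun δ hδ => ?_
  have := key (2 * δ) (by positivity)
  linarith

/-- The form of the Friedrichs extension is real. -/
theorem friedrichs_inner_im {S : H →ₗ.[ℂ] H} {ε : ℝ} (hS : IsStrictlyPositive S ε)
    (v : (friedrichs S hS.isNonneg).domain) :
    (inner ℂ (friedrichs S hS.isNonneg v) (v : H)).im = 0 := by
  obtain ⟨v, hv, w, hw, hc⟩ := v
  change (inner ℂ (S.adjoint ⟨v, hv⟩) v).im = 0
  set L := (inner ℂ (S.adjoint ⟨v, hv⟩) v).im with hL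
  obtain ⟨N₀, hN₀⟩ := hc.eventually_le one_pos
  set M := 2 + 2 * form S (w N₀) with hM
  have hbd : ∀ k ≥ N₀, form S (w k) ≤ M := by
    intro k hk
    have h1 := form_parallelogram S (w k - w N₀) (w N₀)
    rw [sub_add_cancel] at h1
    have h2 := hS.isNonneg.nonneg (w k - w N₀ - w N₀)
    linarith [hN₀ k hk N₀ le_rfl]
  -- As `⟨w k, S (w k)⟩` is real, the imaginary part of `⟨w j, S (w k)⟩` is governed by the
  -- small quantity `form S (w j - w k)` and the bounded quantity `form S (w k)`.
  have key : ∀ t : ℝ, 2 * t * L ≤ 1 + M := by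
    intro t
    obtain ⟨N, hN⟩ := hc.eventually_le (δ := 1 / (t ^ 2 + 1)) (by positivity)
    have h1 : ∀ j ≥ max N N₀, ∀ k ≥ max N N₀,
        2 * t * (inner ℂ (w j : H) (S (w k))).im ≤ 1 + M := by
      intro j hj k hk
      have e1 := two_mul_im_le hS.isNonneg (w j - w k) (w k) t
      have e2 : (inner ℂ (w k : H) (S (w k))).im = 0 := by
        rw [← Complex.conj_eq_iff_im, inner_conj_symm, hS.symm]
      rw [AddSubgroupClass.coe_sub, inner_sub_left, Complex.sub_im, e2, sub_zero] at e1
      have e3 := hN j ((le_max_left _ _).trans hj) k ((le_max_left _ _).trans hk)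
      have e4 : t ^ 2 * form S (w j - w k) ≤ 1 := by
        refine (mul_le_mul_of_nonneg_left e3 (sq_nonneg t)).trans ?_
        rw [mul_one_div, div_le_one (by positivity)]
        linarith
      linarith [hbd k ((le_max_right _ _).trans hk)]
    have h2 : ∀ k ≥ max N N₀, 2 * t * (inner ℂ (S.adjoint ⟨v, hv⟩) (w k : H)).im ≤ 1 + M := by
      intro k hk
      rw [← inner_adjoint_left hS.dense]
      refine le_of_tendsto (((Complex.continuous_im.tendsto _).comp
        (hw.inner tendsto_const_nhds)).const_mul (2 * t)) ?_
      filter_upwards [eventually_ge_atTop (max N N₀)] with j hj using h1 j hj k hk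
    refine le_of_tendsto (((Complex.continuous_im.tendsto _).comp
      (tendsto_const_nhds.inner hw)).const_mul (2 * t)) ?_
    filter_upwards [eventually_ge_atTop (max N N₀)] with k hk using h2 k hk
  by_contra hL0
  have h1 := key ((2 + M) / (2 * L))
  have h2 : 2 * ((2 + M) / (2 * L)) * L = 2 + M := by field_simp
  linarith

/-- The Friedrichs extension is onto. The solution of `S_F v = f` is the limit of a minimizing
sequence for the energy `form S u - 2 Re ⟨f, u⟩`; the parallelogram law makes such a sequence
Cauchy for the form, and the first variation of the energy at the limit gives `S^* v = f`. -/
theorem friedrichs_surjective {S : H →ₗ.[ℂ] H} {ε : ℝ} (hS : IsStrictlyPositive S ε) (f : H) :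
    ∃ v : (friedrichs S hS.isNonneg).domain, friedrichs S hS.isNonneg v = f := by
  set J : S.domain → ℝ := fun u => form S u - 2 * (inner ℂ f (u : H)).re with hJ
  have hε := hS.pos
  have hbdd : BddBelow (Set.range J) := by
    refine ⟨-(‖f‖ ^ 2 / ε), ?_⟩
    rintro _ ⟨u, rfl⟩
    have h1 := hS.bound u
    have h2 : (inner ℂ f (u : H)).re ≤ ‖f‖ * ‖(u : H)‖ := re_inner_le_norm (𝕜 := ℂ) f (u : H)
    have h3 : 0 ≤ ε * (‖(u : H)‖ - ‖f‖ / ε) ^ 2 := by positivity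
    have h4 : ε * (‖(u : H)‖ - ‖f‖ / ε) ^ 2 =
        ε * ‖(u : H)‖ ^ 2 - 2 * (‖f‖ * ‖(u : H)‖) + ‖f‖ ^ 2 / ε := by
      field_simp
      ring
    simp only [hJ]
    linarith
  set m := ⨅ u, J u with hm
  have hmle : ∀ u, m ≤ J u := fun u => ciInf_le hbdd u
  have hex : ∀ j : ℕ, ∃ u, J u < m + 1 / ((j : ℝ) + 1) := fun j =>
    exists_lt_of_ciInf_lt (lt_add_of_pos_right _ Nat.one_div_pos_of_nat)
  choose w hw using hex
  have hc : FormCauchy S w := by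
    have hlim : Tendsto (fun p : ℕ × ℕ => 2 * (1 / ((p.1 : ℝ) + 1)) + 2 * (1 / ((p.2 : ℝ) + 1)))
        atTop (𝓝 0) := by
      have h0 := tendsto_one_div_add_atTop_nhds_zero_nat (𝕜 := ℝ)
      rw [← prod_atTop_atTop_eq]
      simpa using ((h0.comp tendsto_fst).const_mul 2).add ((h0.comp tendsto_snd).const_mul 2)
    refine squeeze_zero (fun p => hS.isNonneg.nonneg _) (fun p => ?_) hlim
    have h1 := form_parallelogram S (w p.1) (w p.2)
    have h2 := hmle (((1 / 2 : ℝ) : ℂ) • (w p.1 + w p.2))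
    simp only [hJ] at h2
    rw [form_real_smul, Submodule.coe_smul, inner_smul_right, Complex.re_ofReal_mul,
      Submodule.coe_add, inner_add_right, Complex.add_re] at h2
    have h3 := hw p.1
    have h4 := hw p.2
    simp only [hJ] at h3 h4
    linarith
  obtain ⟨v, hv⟩ := cauchySeq_tendsto_of_complete (hc.cauchySeq hε hS.bound)
  have hre : ∀ u : S.domain, (inner ℂ v (S u)).re = (inner ℂ f (u : H)).re := by
    intro u
    set d := (inner ℂ v (S u)).re - (inner ℂ f (u : H)).re with hd
    have hvar : ∀ t : ℝ, 0 ≤ 2 * t * d + t ^ 2 * form S u := by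
      intro t
      have h1 : ∀ j : ℕ, -(1 / ((j : ℝ) + 1)) ≤
          2 * t * ((inner ℂ (w j : H) (S u)).re - (inner ℂ f (u : H)).re) + t ^ 2 * form S u := by
        intro j
        have e1 := hmle (w j + (t : ℂ) • u)
        have e2 := hw j
        simp only [hJ] at e1 e2
        rw [form_add hS.symm, form_real_smul, LinearPMap.map_smul, inner_smul_right,
          Complex.re_ofReal_mul, Submodule.coe_add, Submodule.coe_smul, inner_add_right,
          inner_smul_right, Complex.add_re, Complex.re_ofReal_mul] at e1
        linarith
      have h0 := (tendsto_one_div_add_atTop_nhds_zero_nat (𝕜 := ℝ)).neg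
      rw [neg_zero] at h0
      refine le_of_tendsto_of_tendsto h0 ((((((Complex.continuous_re.tendsto _).comp
        (hv.inner tendsto_const_nhds)).sub_const _).const_mul (2 * t)).add_const _)) ?_
      exact Eventually.of_forall h1
    by_contra hne
    have hd0 : d ≠ 0 := sub_ne_zero.2 hne
    -- The quadratic polynomial in `t` is negative at `t = -d / (form S u + 1)`.
    have hq := hS.isNonneg.nonneg u
    have h1 := hvar (-d / (form S u + 1))
    have h2 : 2 * (-d / (form S u + 1)) * d + (-d / (form S u + 1)) ^ 2 * form S u =
        -(d ^ 2 * (form S u + 2)) / (form S u + 1) ^ 2 := by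
      field_simp
      ring
    rw [h2] at h1
    have h3 : 0 < d ^ 2 * (form S u + 2) / (form S u + 1) ^ 2 := by positivity
    rw [neg_div] at h1
    linarith
  have hinner : ∀ u : S.domain, inner ℂ f (u : H) = inner ℂ v (S u) := by
    intro u
    have h1 := hre u
    have h2 := hre (Complex.I • u)
    rw [LinearPMap.map_smul, Submodule.coe_smul, inner_smul_right, inner_smul_right,
      Complex.I_mul_re, Complex.I_mul_re] at h2
    exact Complex.ext h1.symm (neg_injective h2).symm
  have hvd : v ∈ S.adjoint.domain := LinearPMap.mem_adjoint_domain_of_exists v ⟨f, hinner⟩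
  exact ⟨⟨v, hvd, w, hv, hc⟩, LinearPMap.adjoint_apply_eq hS.dense ⟨v, hvd⟩ hinner⟩

/-- The Friedrichs extension has a bounded positive inverse of norm at most `1 / ε`. -/
theorem exists_friedrichs_inverse {S : H →ₗ.[ℂ] H} {ε : ℝ} (hS : IsStrictlyPositive S ε) :
    ∃ B : H →L[ℂ] H, IsResolventAt (friedrichs S hS.isNonneg) 0 B ∧ B.IsPositive ∧
      ‖B‖ ≤ 1 / ε := by
  have hε := hS.pos
  set T := friedrichs S hS.isNonneg with hT
  have hbound : ∀ v : T.domain, ‖(v : H)‖ ≤ 1 / ε * ‖T v‖ := by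
    intro v
    have h1 := friedrichs_lower_bound hS v
    have h2 : (inner ℂ (T v) (v : H)).re ≤ ‖T v‖ * ‖(v : H)‖ :=
      re_inner_le_norm (𝕜 := ℂ) (T v) (v : H)
    rcases (norm_nonneg (v : H)).eq_or_lt with h0 | h0
    · rw [← h0]
      positivity
    · rw [one_div, ← div_eq_inv_mul, le_div_iff₀ hε]
      refine le_of_mul_le_mul_right ?_ h0
      calc ‖(v : H)‖ * ε * ‖(v : H)‖ = ε * ‖(v : H)‖ ^ 2 := by ring
        _ ≤ _ := h1.trans h2
  have hinj : Function.Injective T.toFun := by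
    rw [← LinearMap.ker_eq_bot, LinearMap.ker_eq_bot']
    intro v hv
    have h1 := hbound v
    have hv' : T v = 0 := hv
    rw [hv', norm_zero, mul_zero] at h1
    exact Subtype.ext (norm_le_zero_iff.1 h1)
  let e : T.domain ≃ₗ[ℂ] H := LinearEquiv.ofBijective T.toFun ⟨hinj, friedrichs_surjective hS⟩
  have he : ∀ x, T (e.symm x) = x := fun x => e.apply_symm_apply x
  let B : H →L[ℂ] H := (T.domain.subtype ∘ₗ (e.symm : H →ₗ[ℂ] T.domain)).mkContinuous (1 / ε)
    fun x => by
      have := hbound (e.symm x)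
      rwa [he] at this
  have hB : ∀ x, B x = (e.symm x : H) := fun _ => rfl
  refine ⟨B, ⟨fun x => ⟨(e.symm x).2, ?_⟩, fun u => ?_⟩, ?_,
    LinearMap.mkContinuous_norm_le _ (by positivity) _⟩
  · rw [zero_smul, sub_zero]
    exact he x
  · rw [zero_smul, sub_zero]
    exact congrArg Subtype.val (e.symm_apply_apply u)
  · rw [ContinuousLinearMap.isPositive_iff_complex]
    intro x
    have h1 := friedrichs_lower_bound hS (e.symm x)
    have h2 := friedrichs_inner_im hS (e.symm x)
    change _ ≤ (inner ℂ (T (e.symm x)) (e.symm x : H)).re at h1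
    change (inner ℂ (T (e.symm x)) (e.symm x : H)).im = 0 at h2
    rw [he, ← hB] at h1 h2
    have h3 : inner ℂ (B x) x = inner ℂ x (B x) := by
      rw [← inner_conj_symm, Complex.conj_eq_iff_im.2 h2]
    rw [h3]
    refine ⟨Complex.ext (by simp) (by simp [h2]), ?_⟩
    exact le_trans (by positivity) h1

end Friedrichs

/-! ### The Krein--von Neumann extension and its reduced part -/

section Krein

variable {H : Type*} [NormedAddCommGroup H] [InnerProductSpace ℂ H]

/-- A closed operator bounded below has closed range: a limit of values is a value. -/
theorem exists_apply_eq_of_tendsto [CompleteSpace H] {S : H →ₗ.[ℂ] H} {ε : ℝ}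
    (hS : IsStrictlyPositive S ε) {w : ℕ → S.domain} {y : H}
    (h : Tendsto (fun j => S (w j)) atTop (𝓝 y)) : ∃ x : S.domain, S x = y := by
  have hε := hS.pos
  have hbound : ∀ u : S.domain, ε * ‖(u : H)‖ ≤ ‖S u‖ := by
    intro u
    have h1 := hS.bound u
    have h2 : form S u ≤ ‖(u : H)‖ * ‖S u‖ := re_inner_le_norm (𝕜 := ℂ) (u : H) (S u)
    rcases (norm_nonneg (u : H)).eq_or_lt with h0 | h0
    · rw [← h0, mul_zero]
      exact norm_nonneg _
    · refine le_of_mul_le_mul_left ?_ h0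
      calc ‖(u : H)‖ * (ε * ‖(u : H)‖) = ε * ‖(u : H)‖ ^ 2 := by ring
        _ ≤ _ := h1.trans h2
  have hcauchy : CauchySeq fun j => (w j : H) := by
    have h1 := h.cauchySeq
    rw [Metric.cauchySeq_iff] at h1 ⊢
    intro δ hδ
    obtain ⟨N, hN⟩ := h1 (ε * δ) (by positivity)
    refine ⟨N, fun j hj k hk => ?_⟩
    have h2 := hN j hj k hk
    have h3 := hbound (w j - w k)
    rw [dist_eq_norm] at h2 ⊢
    rw [LinearPMap.map_sub] at h3
    exact lt_of_mul_lt_mul_left (h3.trans_lt h2) hε.le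
  obtain ⟨x, hx⟩ := cauchySeq_tendsto_of_complete hcauchy
  have hmem : (x, y) ∈ S.graph := by
    have hcl : IsClosed (S.graph : Set (H × H)) := hS.closed
    exact hcl.mem_of_tendsto (hx.prodMk_nhds h) (Eventually.of_forall fun j => S.mem_graph (w j))
  obtain ⟨u, -, hu⟩ := (LinearPMap.mem_graph_iff S).1 hmem
  exact ⟨u, hu⟩

theorem mem_ker_iff {T : H →ₗ.[ℂ] H} {x : H} :
    x ∈ ker T ↔ ∃ hx : x ∈ T.domain, T ⟨x, hx⟩ = 0 := by
  constructor
  · rintro ⟨u, hu, rfl⟩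
    exact ⟨u.2, hu⟩
  · rintro ⟨hx, h⟩
    exact ⟨⟨x, hx⟩, h, rfl⟩

variable [CompleteSpace H] {S : H →ₗ.[ℂ] H} {ε : ℝ}

theorem le_adjoint_apply (hS : IsStrictlyPositive S ε) (u : S.domain) :
    ∃ hu : (u : H) ∈ S.adjoint.domain, S.adjoint ⟨u, hu⟩ = S u := by
  have h := hS.symm.le_adjoint hS.dense
  exact ⟨h.1 u.2, (h.2 (x := u) (y := ⟨u, h.1 u.2⟩) rfl).symm⟩

theorem mem_ker_adjoint_iff (hd : Dense (S.domain : Set H)) {x : H} :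
    x ∈ ker S.adjoint ↔ x ∈ (LinearMap.range S.toFun)ᗮ := by
  rw [mem_ker_iff, Submodule.mem_orthogonal']
  constructor
  · rintro ⟨hx, h0⟩ _ ⟨u, rfl⟩
    have := inner_adjoint_left hd ⟨x, hx⟩ u
    rw [h0, inner_zero_left] at this
    exact this
  · intro h
    have h' : ∀ u : S.domain, inner ℂ (0 : H) (u : H) = inner ℂ x (S u) := fun u => by
      rw [inner_zero_left]
      exact (h _ ⟨u, rfl⟩).symm
    have hx := LinearPMap.mem_adjoint_domain_of_exists x ⟨0, h'⟩
    exact ⟨hx, LinearPMap.adjoint_apply_eq hd ⟨x, hx⟩ h'⟩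

/-- On `dom(S) + ker(S^*)`, the Krein--von Neumann extension acts as `S` on the first summand. -/
theorem krein_apply_add (hS : IsStrictlyPositive S ε) (u : S.domain) {k : H}
    (hk : k ∈ ker S.adjoint) :
    ∃ h : (u : H) + k ∈ (krein S hS.isNonneg).domain,
      krein S hS.isNonneg ⟨u + k, h⟩ = S u := by
  obtain ⟨hu, hSu⟩ := le_adjoint_apply hS u
  obtain ⟨hk, hSk⟩ := mem_ker_iff.1 hk
  have h1 : S.adjoint ⟨(u : H) + k, add_mem hu hk⟩ = S u := by
    have := S.adjoint.map_add ⟨u, hu⟩ ⟨k, hk⟩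
    rw [hSu, hSk, add_zero] at this
    exact this
  refine ⟨⟨add_mem hu hk, fun _ => u, ?_, ?_⟩, h1⟩
  · rw [h1]
    exact tendsto_const_nhds
  · simp [FormCauchy, form]

/-- The domain of the Krein--von Neumann extension is `dom(S) + ker(S^*)`. -/
theorem exists_of_mem_krein_domain (hS : IsStrictlyPositive S ε)
    (v : (krein S hS.isNonneg).domain) :
    ∃ u : S.domain, krein S hS.isNonneg v = S u ∧ (v : H) - u ∈ ker S.adjoint := by
  obtain ⟨v, hv, w, hw, hc⟩ := v
  obtain ⟨u, hu⟩ := exists_apply_eq_of_tendsto hS hw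
  obtain ⟨hu', hSu⟩ := le_adjoint_apply hS u
  refine ⟨u, hu.symm, mem_ker_iff.2 ⟨sub_mem hv hu', ?_⟩⟩
  have := S.adjoint.map_sub ⟨v, hv⟩ ⟨u, hu'⟩
  rw [hSu, hu, sub_self] at this
  exact this

theorem ker_krein (hS : IsStrictlyPositive S ε) :
    ker (krein S hS.isNonneg) = (LinearMap.range S.toFun)ᗮ := by
  ext x
  rw [← mem_ker_adjoint_iff hS.dense]
  constructor
  · intro h
    obtain ⟨hx, h0⟩ := mem_ker_iff.1 h
    exact mem_ker_iff.2 ⟨kreinDomain_le S hS.isNonneg hx, h0⟩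
  · intro h
    obtain ⟨hx, h0⟩ := krein_apply_add hS 0 h
    simp only [ZeroMemClass.coe_zero, zero_add, LinearPMap.map_zero] at hx h0
    exact mem_ker_iff.2 ⟨hx, h0⟩

/-- The orthogonal complement of `ker S_K` is the (closed) range of `S`. -/
theorem mem_ker_krein_orthogonal_iff (hS : IsStrictlyPositive S ε) {y : H} :
    y ∈ (ker (krein S hS.isNonneg))ᗮ ↔ ∃ u : S.domain, S u = y := by
  rw [ker_krein hS, Submodule.orthogonal_orthogonal_eq_closure]
  constructor
  · intro hy
    have hy' : y ∈ closure (LinearMap.range S.toFun : Set H) := hy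
    obtain ⟨x, hx, hlim⟩ := mem_closure_iff_seq_limit.1 hy'
    have hx' : ∀ n, ∃ u : S.domain, S u = x n := hx
    choose w hw using hx'
    exact exists_apply_eq_of_tendsto hS (w := w) (by simpa only [hw] using hlim)
  · rintro ⟨u, rfl⟩
    exact Submodule.le_topologicalClosure _ ⟨u, rfl⟩

theorem sub_projection_mem_ker_krein (hS : IsStrictlyPositive S ε) (x : H) :
    x - (ker (krein S hS.isNonneg))ᗮ.orthogonalProjectionOnto x ∈ ker (krein S hS.isNonneg) := by
  have h : x - (ker (krein S hS.isNonneg))ᗮ.starProjection x ∈ (ker (krein S hS.isNonneg))ᗮᗮ :=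
    Submodule.sub_starProjection_mem_orthogonal x
  have hcl : (ker (krein S hS.isNonneg))ᗮᗮ = ker (krein S hS.isNonneg) := by
    rw [ker_krein hS, Submodule.triorthogonal_eq_orthogonal]
  rwa [hcl] at h

/-- The values of `S_K` are values of `S`, hence already orthogonal to `ker S_K`: the projection in
the definition of the reduced part is redundant. -/
theorem reducedPart_krein_apply (hS : IsStrictlyPositive S ε)
    (v : (reducedPart (krein S hS.isNonneg)).domain) :
    ((reducedPart (krein S hS.isNonneg) v : (ker (krein S hS.isNonneg))ᗮ) : H) =
      krein S hS.isNonneg ⟨((v : (ker (krein S hS.isNonneg))ᗮ) : H), v.2⟩ := by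
  set w := krein S hS.isNonneg ⟨((v : (ker (krein S hS.isNonneg))ᗮ) : H), v.2⟩ with hw
  have hmem : w ∈ (ker (krein S hS.isNonneg))ᗮ := by
    obtain ⟨u, hu, -⟩ := exists_of_mem_krein_domain hS
      ⟨((v : (ker (krein S hS.isNonneg))ᗮ) : H), v.2⟩
    exact (mem_ker_krein_orthogonal_iff hS).2 ⟨u, hu.symm⟩
  exact congrArg Subtype.val
    ((ker (krein S hS.isNonneg))ᗮ.orthogonalProjectionOnto_mem_subspace_eq_self ⟨w, hmem⟩)

/-- The compression to `(ker S_K)ᗮ` of any bounded left inverse of `S` is the inverse of the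
reduced Krein--von Neumann operator. -/
theorem isResolventAt_reducedPart_zero (hS : IsStrictlyPositive S ε) {B : H →L[ℂ] H}
    (hB : ∀ u : S.domain, B (S u) = u) :
    IsResolventAt (reducedPart (krein S hS.isNonneg)) 0
      ((ker (krein S hS.isNonneg))ᗮ.orthogonalProjectionOnto ∘L B ∘L
        (ker (krein S hS.isNonneg))ᗮ.subtypeL) := by
  set K := (ker (krein S hS.isNonneg))ᗮ with hK
  refine ⟨fun x => ?_, fun v => ?_⟩
  · obtain ⟨u, hu⟩ := (mem_ker_krein_orthogonal_iff hS).1 x.2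
    have hBx : B x = u := by rw [← hu, hB]
    have hk := sub_projection_mem_ker_krein hS (u : H)
    rw [ker_krein hS, ← mem_ker_adjoint_iff hS.dense, ← ker_krein hS] at hk
    obtain ⟨h1, h2⟩ := krein_apply_add hS u (neg_mem hk)
    have e : (u : H) + -((u : H) - K.orthogonalProjectionOnto u) =
        K.orthogonalProjectionOnto (B x) := by
      rw [hBx]
      abel
    have hx : K.orthogonalProjectionOnto (B x) ∈ (reducedPart (krein S hS.isNonneg)).domain := by
      change (K.orthogonalProjectionOnto (B x) : H) ∈ (krein S hS.isNonneg).domain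
      rw [← e]
      exact h1
    refine ⟨hx, ?_⟩
    rw [zero_smul, sub_zero]
    apply Subtype.ext
    refine (reducedPart_krein_apply hS ⟨_, hx⟩).trans ?_
    exact (congrArg (krein S hS.isNonneg) (Subtype.ext e.symm)).trans (h2.trans hu)
  · obtain ⟨u, hu, hk⟩ := exists_of_mem_krein_domain hS ⟨((v : K) : H), v.2⟩
    rw [zero_smul, sub_zero]
    change K.orthogonalProjectionOnto (B (reducedPart (krein S hS.isNonneg) v : K)) = v
    rw [reducedPart_krein_apply hS, hu, hB]
    have h1 : K.orthogonalProjectionOnto (((v : K) : H) - u) = 0 := by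
      rw [mem_ker_adjoint_iff hS.dense, ← ker_krein hS] at hk
      exact Submodule.orthogonalProjectionOnto_orthogonal_apply_eq_zero hk
    rw [map_sub, sub_eq_zero, Submodule.orthogonalProjectionOnto_mem_subspace_eq_self] at h1
    exact h1.symm

/-- If `T` is reduced by its closed kernel, the resolvent of `T` is the orthogonal sum of the
resolvent of its reduced part and of `-z⁻¹` on the kernel. -/
theorem isResolventAt_of_reducedPart {T : H →ₗ.[ℂ] H}
    (hker : ∀ x : H, x - (ker T)ᗮ.orthogonalProjectionOnto x ∈ ker T)
    (hred : ∀ v : (reducedPart T).domain,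
      ((reducedPart T v : (ker T)ᗮ) : H) = T ⟨((v : (ker T)ᗮ) : H), v.2⟩)
    {z : ℂ} (hz : z ≠ 0) {R : (ker T)ᗮ →L[ℂ] (ker T)ᗮ}
    (hR : IsResolventAt (reducedPart T) z R) :
    IsResolventAt T z (extendZero (ker T)ᗮ R - z⁻¹ • (1 - (ker T)ᗮ.starProjection)) := by
  have hval : ∀ x : H, (extendZero (ker T)ᗮ R - z⁻¹ • (1 - (ker T)ᗮ.starProjection)) x =
      (R ((ker T)ᗮ.orthogonalProjectionOnto x) : H) -
        z⁻¹ • (x - (ker T)ᗮ.orthogonalProjectionOnto x) :=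
    fun _ => rfl
  refine ⟨fun x => ?_, fun v => ?_⟩
  · obtain ⟨h1', h2⟩ := hR.1 ((ker T)ᗮ.orthogonalProjectionOnto x)
    have h1 : (R ((ker T)ᗮ.orthogonalProjectionOnto x) : H) ∈ T.domain := h1'
    obtain ⟨h3, h4⟩ := mem_ker_iff.1 (hker x)
    rw [hval]
    refine ⟨sub_mem h1 (Submodule.smul_mem _ _ h3), ?_⟩
    have e1 : T ⟨_, sub_mem h1 (Submodule.smul_mem _ z⁻¹ h3)⟩ =
        T ⟨_, h1⟩ - z⁻¹ • T ⟨_, h3⟩ := by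
      rw [← LinearPMap.map_smul, ← LinearPMap.map_sub]
      rfl
    have e2 := congrArg Subtype.val h2
    rw [AddSubgroupClass.coe_sub, hred, Submodule.coe_smul] at e2
    rw [e1, h4, smul_zero, sub_zero, smul_sub, smul_smul, mul_inv_cancel₀ hz, one_smul,
      sub_sub_eq_add_sub, add_sub_right_comm]
    refine (congrArg (· + (x - (ker T)ᗮ.orthogonalProjectionOnto x : H)) e2).trans ?_
    exact add_sub_cancel _ _
  · obtain ⟨h3, h4⟩ := mem_ker_iff.1 (hker v)
    have hPv : ((ker T)ᗮ.orthogonalProjectionOnto (v : H) : H) ∈ T.domain := by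
      have := sub_mem v.2 h3
      rwa [sub_sub_cancel] at this
    have e1 : T v = T ⟨_, hPv⟩ := by
      have := T.map_sub v ⟨_, h3⟩
      rw [h4, sub_zero] at this
      rw [← this]
      exact congrArg T (Subtype.ext (sub_sub_cancel _ _))
    have e2 := hred ⟨(ker T)ᗮ.orthogonalProjectionOnto (v : H), hPv⟩
    have e3 := hR.2 ⟨(ker T)ᗮ.orthogonalProjectionOnto (v : H), hPv⟩
    have e4 : (ker T)ᗮ.orthogonalProjectionOnto (T v - z • (v : H)) =
        reducedPart T ⟨(ker T)ᗮ.orthogonalProjectionOnto (v : H), hPv⟩ -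
          z • (ker T)ᗮ.orthogonalProjectionOnto (v : H) := by
      rw [map_sub, map_smul, e1]
      congr 1
    rw [hval, e4, e3, e1, ← e2, AddSubgroupClass.coe_sub, Submodule.coe_smul]
    have e5 : z⁻¹ • (z • (v : H)) = v := by rw [smul_smul, inv_mul_cancel₀ hz, one_smul]
    have e6 : z⁻¹ • (z • ((ker T)ᗮ.orthogonalProjectionOnto (v : H) : H)) =
        (ker T)ᗮ.orthogonalProjectionOnto (v : H) := by
      rw [smul_smul, inv_mul_cancel₀ hz, one_smul]
    simp only [smul_sub, e5, e6]
    abel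

theorem one_sub_kerProj (T : H →ₗ.[ℂ] H) : 1 - kerProj T = (ker T)ᗮ.starProjection := by
  have h : (ker T).topologicalClosureᗮ.starProjection = (ker T)ᗮ.starProjection := by
    congr 1
    exact Submodule.orthogonal_closure _
  rw [← h]
  ext x
  have h' := (ker T).topologicalClosure.starProjection_add_starProjection_orthogonal x
  exact sub_eq_of_eq_add' h'.symm

theorem analyticAt_inverse_one_sub_smul {R : Type*} [NormedRing R] [NormedAlgebra ℂ R]
    [CompleteSpace R] (a : R) {z : ℂ} (hz : IsUnit (1 - z • a)) :
    AnalyticAt ℂ (fun z : ℂ => Ring.inverse (1 - z • a)) z := by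
  have h : AnalyticAt ℂ (fun z : ℂ => 1 - z • a) z := by fun_prop
  obtain ⟨U, hU⟩ := hz
  refine AnalyticAt.comp (g := Ring.inverse) ?_ h
  rw [← hU]
  exact analyticAt_inverse U

theorem analyticOnNhd_extendZero_mul_inverse (K : Submodule ℂ H) [K.HasOrthogonalProjection]
    [CompleteSpace K] (A : K →L[ℂ] K) {s : Set ℂ} (hs : ∀ z ∈ s, IsUnit (1 - z • A)) :
    AnalyticOnNhd ℂ (fun z : ℂ => extendZero K (A * Ring.inverse (1 - z • A))) s := by
  intro z hz
  let Φ : (K →L[ℂ] K) →L[ℂ] (H →L[ℂ] H) :=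
    (ContinuousLinearMap.compL ℂ H K H K.subtypeL) ∘L
      ((ContinuousLinearMap.compL ℂ H K K).flip K.orthogonalProjectionOnto) ∘L
      (ContinuousLinearMap.mul ℂ (K →L[ℂ] K) A)
  exact (Φ.analyticAt _).comp (analyticAt_inverse_one_sub_smul A (hs z hz))

end Krein

end KreinVonNeumann

open KreinVonNeumann in
theorem theorem4p1 {H : Type*} [NormedAddCommGroup H] [InnerProductSpace ℂ H] [CompleteSpace H]
    [TopologicalSpace.SeparableSpace H] (S : H →ₗ.[ℂ] H) (ε : ℝ) (hS : IsStrictlyPositive S ε) :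
    -- the resolvents in the claim exist
    (∀ z ∈ cutPlane ε, z ∈ rho (friedrichs S hS.isNonneg)) ∧
    (∀ z ∈ cutPlane ε, z ≠ 0 → z ∈ rho (krein S hS.isNonneg)) ∧
    (∀ z ∈ cutPlane ε, z ∈ rho (reducedPart (krein S hS.isNonneg))) ∧
    -- `G z` is `(S_K - z)⁻¹ [I - P_{ker S_K}]`, continued analytically to `z = 0`
    (∃ G : ℂ → H →L[ℂ] H,
      AnalyticOnNhd ℂ G (cutPlane ε) ∧
      (∀ z ∈ cutPlane ε, z ≠ 0 →
        G z = resolventOp (krein S hS.isNonneg) z ∘L (1 - kerProj (krein S hS.isNonneg))) ∧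
      (∀ p : ℝ≥0∞, 0 < p →
        (∀ z ∈ cutPlane ε, IsSchatten p (G z) ↔
          IsSchatten p (resolventOp (reducedPart (krein S hS.isNonneg)) z)) ∧
        ((∃ z₀ ∈ cutPlane ε, IsSchatten p (resolventOp (friedrichs S hS.isNonneg) z₀)) →
          ∀ z ∈ cutPlane ε, IsSchatten p (G z) ∧
            IsSchatten p (resolventOp (reducedPart (krein S hS.isNonneg)) z))) ∧
      (∀ J : SymmNormedIdeal H,
        (∀ z ∈ cutPlane ε, G z ∈ J.carrier ↔
          resolventOp (reducedPart (krein S hS.isNonneg)) z ∈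
            J.onSubspace (ker (krein S hS.isNonneg))ᗮ) ∧
        ((∃ z₀ ∈ cutPlane ε, resolventOp (friedrichs S hS.isNonneg) z₀ ∈ J.carrier) →
          ∀ z ∈ cutPlane ε, G z ∈ J.carrier ∧
            resolventOp (reducedPart (krein S hS.isNonneg)) z ∈
              J.onSubspace (ker (krein S hS.isNonneg))ᗮ))) ∧
    -- arbitrary boundedly invertible self-adjoint extensions
    (∀ p : ℝ≥0∞, 0 < p → ∀ S' : H →ₗ.[ℂ] H, S ≤ S' → IsSelfAdjoint S' → 0 ∈ rho S' →
      IsSchatten p (resolventOp S' 0) →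
        IsSchatten p (resolventOp (reducedPart (krein S hS.isNonneg)) 0)) := by
  obtain ⟨B, hB, hBpos, hBn⟩ := exists_friedrichs_inverse hS
  have hBS : ∀ u : S.domain, B (S u) = u := by
    intro u
    obtain ⟨hu, hSu⟩ := le_adjoint_apply hS u
    have hF : (u : H) ∈ (friedrichs S hS.isNonneg).domain :=
      ⟨hu, fun _ => u, tendsto_const_nhds, by simp [FormCauchy, form]⟩
    have h1 := hB.2 ⟨u, hF⟩
    rw [zero_smul, sub_zero] at h1
    rw [← hSu]
    exact h1
  set T := krein S hS.isNonneg with hT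
  set K := (ker T)ᗮ with hK
  set A : K →L[ℂ] K := K.orthogonalProjectionOnto ∘L B ∘L K.subtypeL with hA
  have hAres : IsResolventAt (reducedPart T) 0 A := isResolventAt_reducedPart_zero hS hBS
  have hApos : A.IsPositive := hBpos.orthogonalProjectionOnto_comp K
  have hAn : ‖A‖ ≤ 1 / ε := by
    refine (ContinuousLinearMap.opNorm_comp_le _ _).trans ?_
    refine (mul_le_mul K.orthogonalProjectionOnto_norm_le
      (ContinuousLinearMap.opNorm_comp_le _ _) (norm_nonneg _) zero_le_one).trans ?_
    rw [one_mul]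
    exact (mul_le_of_le_one_right (norm_nonneg _) K.norm_subtypeL_le).trans hBn
  have hFz : ∀ z ∈ cutPlane ε, IsResolventAt (friedrichs S hS.isNonneg) z
      (B * Ring.inverse (1 - z • B)) := fun z hz =>
    hB.mul_inverse (isUnit_one_sub_smul hS.pos hBpos hBn hz)
  have hAu : ∀ z ∈ cutPlane ε, IsUnit (1 - z • A) := fun z hz =>
    isUnit_one_sub_smul hS.pos hApos hAn hz
  have hAz : ∀ z ∈ cutPlane ε, IsResolventAt (reducedPart T) z
      (A * Ring.inverse (1 - z • A)) := fun z hz => hAres.mul_inverse (hAu z hz)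
  have hKz : ∀ z ∈ cutPlane ε, z ≠ 0 → IsResolventAt T z
      (extendZero K (A * Ring.inverse (1 - z • A)) - z⁻¹ • (1 - K.starProjection)) :=
    fun z hz hz0 => isResolventAt_of_reducedPart (sub_projection_mem_ker_krein hS)
      (reducedPart_krein_apply hS) hz0 (hAz z hz)
  have hred : ∀ z ∈ cutPlane ε,
      resolventOp (reducedPart T) z = A * Ring.inverse (1 - z • A) :=
    fun z hz => (hAz z hz).resolventOp_eq
  -- `S_F⁻¹` is recovered from the resolvent at `z₀` by a multiplication with `1 - z₀ S_F⁻¹`.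
  have hBeq : ∀ z ∈ cutPlane ε,
      resolventOp (friedrichs S hS.isNonneg) z * (1 - z • B) = B := fun z hz => by
    rw [(hFz z hz).resolventOp_eq, mul_assoc,
      Ring.inverse_mul_cancel _ (isUnit_one_sub_smul hS.pos hBpos hBn hz), mul_one]
  refine ⟨fun z hz => (hFz z hz).mem_rho, fun z hz hz0 => (hKz z hz hz0).mem_rho,
    fun z hz => (hAz z hz).mem_rho,
    ⟨fun z => extendZero K (A * Ring.inverse (1 - z • A)),
      analyticOnNhd_extendZero_mul_inverse K A hAu, fun z hz hz0 => ?_, fun p _ => ?_,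
      fun J => ?_⟩, fun p _ S' hSS' _ h0 hp => ?_⟩
  · have hP : 1 - kerProj T = K.starProjection := one_sub_kerProj T
    rw [(hKz z hz hz0).resolventOp_eq, hP]
    ext x
    have hPP : K.orthogonalProjectionOnto (K.starProjection x) = K.orthogonalProjectionOnto x :=
      K.orthogonalProjectionOnto_mem_subspace_eq_self _
    have hPP' : K.starProjection (K.starProjection x) = K.starProjection x :=
      congrArg Subtype.val hPP
    simp [extendZero, hPP, hPP']
  · refine ⟨fun z hz => ?_, ?_⟩
    · rw [hred z hz]
      exact isSchatten_extendZero_iff K _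
    · rintro ⟨z₀, hz₀, h⟩ z hz
      have hBp : IsSchatten p B := by
        rw [← hBeq z₀ hz₀]
        exact h.mul_right _
      have hAp : IsSchatten p (A * Ring.inverse (1 - z • A)) :=
        (hBp.comp K.orthogonalProjectionOnto K.subtypeL).mul_right _
      rw [hred z hz]
      exact ⟨(isSchatten_extendZero_iff K _).2 hAp, hAp⟩
  · refine ⟨fun z hz => ?_, ?_⟩
    · rw [hred z hz]
      rfl
    · rintro ⟨z₀, hz₀, h⟩ z hz
      have hBJ : B ∈ J.carrier := by
        rw [← hBeq z₀ hz₀]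
        exact J.mul_right_mem h _
      have hAJ : extendZero K (A * Ring.inverse (1 - z • A)) ∈ J.carrier := by
        rw [extendZero_mul]
        exact J.mul_right_mem (J.mul_mem K.starProjection K.starProjection hBJ) _
      rw [hred z hz]
      exact ⟨hAJ, hAJ⟩
  · have hB' := isResolventAt_resolventOp h0
    have hB'S : ∀ u : S.domain, resolventOp S' 0 (S u) = u := fun u => by
      have h1 := hB'.2 ⟨u, hSS'.1 u.2⟩
      rw [zero_smul, sub_zero] at h1
      rw [hSS'.2 (x := u) (y := ⟨u, hSS'.1 u.2⟩) rfl]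
      exact h1
    rw [(isResolventAt_reducedPart_zero hS hB'S).resolventOp_eq]
    exact hp.comp K.orthogonalProjectionOnto K.subtypeL
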